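/- Let $T$ be a triangle of any shape in the Euclidean plane with a selected side, and let the length of the selected side be $n+d$ with $n\in\mathbb N$ and $d\in(0,1)$. A homothetic unit triangle is an image of $T$ under a map $x\mapsto v+rx$ with $r=\pm\frac1{n+d}$ (so that its selected side has length $1$); it is an up-triangle if $r>0$ and a down-triangle if $r<0$. Draw $T$ with the selected side as its horizontal base. For $2\le j\le n+1$, the method CoverTriangle (Basic Odd) with parameter $j$ starts at the apex of $T$ and stacks, along the left diagonal of $T$, rows $1,\dots,n$ of homothetic unit triangles, up- and down-triangles alternating. Row $1$ is the usual covering of a triangle of side $2$ with $4$ unit triangles. Row $k$ with $1<k<j$ is the usual row of $k+1$ up- and $k$ down-triangles. Row $k$ with $j\le k\le n$ has $k$ up- and $k-1$ down-triangles, and each down-triangle is slid down and rightward, along the right leg of the preceding up-triangle, by $s_k=\frac{j-1}{k(k-1)}$, pushing all subsequent triangles of the row to the right by $s_k$; the line through the horizontal legs of its down-triangles is placed on the base line of the preceding row, so the row adds $1-s_k$ to the length of the left diagonal. CoverTriangle (Full Odd) is this method with $j=\lceil dn+1\rceil$. CoverTriangle (Full Odd) is an optimal method for covering $T$ with $n^2+2p+1$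 homothetic unit triangles, for every integer $p$ with $1\le p<n$. That is: 1. CoverTriangle (Full Odd) covers $T$, and uses $n^2+2(\lceil dn+1\rceil-1)+1$ homothetic unit triangles. This number is at most $n^2+2p+1$ if and only if $d\le\frac pn$. 2. If $d\le\frac pn$, then the method with $j=p+1$ covers $T$ with exactly $n^2+2p+1$ homothetic unit triangles. 3. If $d>\frac pn$, then $T$ cannot be covered with $n^2+2p+1$ homothetic unit triangles, however they are placed. -/

import Mathlib

noncomputable section

namespace TriangleCovering

/-- The Euclidean plane. -/
abbrev Plane := EuclideanSpace ℝ (Fin 2)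

/-- Length of the selected side of a triangle: the side joining the vertices `0` and `1`.
Vertex `2` is the vertex opposite to the selected side. -/
def selectedSide (T : Affine.Triangle ℝ Plane) : ℝ :=
  dist (T.points 0) (T.points 1)

/-- `S` is a unit triangle homothetic to `T`: the image of the (solid) triangle `T` under a map
`x ↦ v + r • x`, with `r` positive or negative, that takes the selected side to a segment of
length `1`. -/
def IsHomotheticUnit (T : Affine.Triangle ℝ Plane) (S : Set Plane) : Prop :=
  ∃ (r : ℝ) (v : Plane), |r| * selectedSide T = 1 ∧ S = (fun x => v + r • x) '' T.closedInterior

/-- The list `L` consists of unit triangles homothetic to `T`, and together they cover `T`. -/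
def IsUnitCovering (T : Affine.Triangle ℝ Plane) (L : List (Set Plane)) : Prop :=
  (∀ S ∈ L, IsHomotheticUnit T S) ∧ T.closedInterior ⊆ {x | ∃ S ∈ L, x ∈ S}

/-- `T` can be covered with `N` unit triangles homothetic to `T`, by whatever method. -/
def CanBeCoveredWith (T : Affine.Triangle ℝ Plane) (N : ℕ) : Prop :=
  ∃ L : List (Set Plane), L.length = N ∧ IsUnitCovering T L

/-- Orientation of a unit triangle: an up-triangle is a translate of the unit triangle that points
the same way as the large triangle, a down-triangle is a translate of its point reflection. -/
inductive Orientation where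
  | up
  | down

/-- The placement of one unit triangle: its orientation and the position of its distinguished
vertex (the apex of an up-triangle, the nadir of a down-triangle). The position is given in oblique
coordinates with origin at the apex of the large triangle, in units of the length of the unit
triangle's corresponding legs: `depth` is measured down along the left diagonal, `shift` to the
right along the selected side. -/
structure Placement where
  orientation : Orientation
  depth : ℝ
  shift : ℝ

/-- The point of the plane with given oblique coordinates. With the selected side (from the left
vertex `0` to the right vertex `1`) drawn as the base of `T`, and vertex `2` as its apex, the solid
triangle `T` is the set of points with `0 ≤ shift ≤ depth ≤ selectedSide T`. -/
def obliquePoint (T : Affine.Triangle ℝ Plane) (depth shift : ℝ) : Plane :=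
  T.points 2 + (depth / selectedSide T) • (T.points 0 - T.points 2)
    + (shift / selectedSide T) • (T.points 1 - T.points 0)

/-- The solid unit triangle described by a placement: the copy of `T`, scaled by plus or minus
`1 / selectedSide T`, whose vertex corresponding to the apex of `T` is the prescribed point. -/
def Placement.toSet (T : Affine.Triangle ℝ Plane) : Placement → Set Plane
  | ⟨.up, a, b⟩ =>
      (fun x => obliquePoint T a b + (1 / selectedSide T) • (x - T.points 2)) '' T.closedInterior
  | ⟨.down, a, b⟩ =>
      (fun x => obliquePoint T a b - (1 / selectedSide T) • (x - T.points 2)) '' T.closedInterior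

/-- A row of `w` up-triangles, alternating with `w - 1` down-triangles, in which the bases of the
up-triangles lie at depth `y`, after the down-right slide operation with slide value `s`: each
down-triangle is slid by `s` down and rightward along the right leg of the preceding up-triangle,
and pushes all the later triangles of the row to the right by `s`. For `s = 0` this is the usual
row of abutting triangles. -/
def row (w : ℕ) (y s : ℝ) : List Placement :=
  (List.range w).map (fun i => ⟨.up, y - 1, (i : ℝ) * (1 + s)⟩) ++
    (List.range (w - 1)).map (fun i => ⟨.down, y + s, ((i : ℝ) + 1) * (1 + s)⟩)

/-- The slide value of row `k ≥ j`. -/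
def slideValue (j k : ℕ) : ℝ :=
  ((j : ℝ) - 1) / ((k : ℝ) * ((k : ℝ) - 1))

/-- The depth at which the bases of the up-triangles of row `k ≥ j` lie. The rows before row `j`
fill the depths from `0` to `j`; each row `i ≥ j`, with slide value `s`, is stacked below the
preceding one and adds a trapezoid of diagonal length `1 - s`. -/
def rowDepth (j k : ℕ) : ℝ :=
  (j : ℝ) + ∑ i ∈ Finset.Icc j k, (1 - slideValue j i)

/-- Row `k ≥ 1` of the method CoverTriangle (Basic Odd) with parameter `j`: row `1` is the usual
covering of a triangle of side `2`; a row `1 < k < j` gets one extra pair of triangles and no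
slide; a row `k ≥ j` gets no extra triangles, and the down-right slide operation is applied. -/
def basicOddRow (j k : ℕ) : List Placement :=
  if k = 1 then row 1 1 0 ++ row 2 2 0
  else if k < j then row (k + 1) ((k : ℝ) + 1) 0
  else row k (rowDepth j k) (slideValue j k)

/-- The placements chosen by CoverTriangle (Basic Odd): the rows `1, …, n`. -/
def basicOddPlacements (n j : ℕ) : List Placement :=
  (List.range n).flatMap (fun i => basicOddRow j (i + 1))

/-- The unit triangles that CoverTriangle (Basic Odd) with parameter `j` places to cover `T`. -/
def basicOdd (n j : ℕ) (T : Affine.Triangle ℝ Plane) : List (Set Plane) :=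
  (basicOddPlacements n j).map (Placement.toSet T)

/-- The row selected by CoverTriangle (Full Odd). -/
def fullOddRow (n : ℕ) (d : ℝ) : ℕ := ⌈d * n + 1⌉₊

/-- CoverTriangle (Full Odd): CoverTriangle (Basic Odd) with `j = ⌈d * n + 1⌉`. If `j = n + 1`,
no row is slid, and the result is the naive covering of a triangle of side `n + 1`. -/
def fullOdd (n : ℕ) (d : ℝ) (T : Affine.Triangle ℝ Plane) : List (Set Plane) :=
  basicOdd n (fullOddRow n d) T

end TriangleCovering

end

noncomputable section

namespace TriangleCovering

open MeasureTheory

/-! ### Oblique coordinates -/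

/-! Lower bound. In oblique coordinates the slice of `T` at depth `x` has length `x`. For almost
every `t` in `[0, 1]`, adding the slices at depths `t`, `t + 1`, … inside `T` gives `G t = M * t +
integer`, with `M = n + 1` for `t < d` and `M = n` otherwise. A unit triangle contributes at most
one sawtooth `fract (±(t - a))`, so the sum `F` of the sawtooths is at least `G`. Integrating this
yields only the area bound. The gain comes from congruence: modulo `1`, `F` is `D * t + c`, where
`D` is the number of up-triangles minus the number of down-triangles, so the excess `F - G ≥ 0` is
at least `fract ((D - M) * t + c)` (`add_fract_le`). If the number `N` of triangles has the parity
of `n + 1`, then `D ≠ n`, and a sawtooth of nonzero integer slope `D - n` has mean `1 / 2`. This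
yields `N ≥ n² + 2nd + 1` (`Covers.le_length`).

Construction. A slid row of `k` up-triangles has base length `k + (k - 1) * s`, which must equal the
depth it reaches. With `s = (j - 1) / (k * (k - 1))` the gains `1 - s` telescope to depth `k + (j -
1) / k`, and this is exactly that length (`rowDepth_eq`, `exists_mem_basicOddRow`). After `n` rows
the side covered is `n + (j - 1) / n`. -/

theorem selectedSide_pos (T : Affine.Triangle ℝ Plane) : 0 < selectedSide T :=
  dist_pos.2 (T.independent.injective.ne (by decide))

/-- The weights are barycentric coordinates, so membership in `T` becomes a condition on their
signs. -/
theorem obliquePoint_eq_affineCombination (T : Affine.Triangle ℝ Plane) (x y : ℝ) :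
    obliquePoint T x y = Finset.univ.affineCombination ℝ T.points
      ![(x - y) / selectedSide T, y / selectedSide T, 1 - x / selectedSide T] := by
  rw [Finset.affineCombination_eq_linear_combination]
  · rw [Fin.sum_univ_three]
    simp only [obliquePoint, Matrix.cons_val]
    module
  · rw [Fin.sum_univ_three]
    simp only [Matrix.cons_val]
    ring

theorem obliquePoint_mem_closedInterior_iff (T : Affine.Triangle ℝ Plane) (x y : ℝ) :
    obliquePoint T x y ∈ T.closedInterior ↔ 0 ≤ y ∧ y ≤ x ∧ x ≤ selectedSide T := by
  have hS := selectedSide_pos T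
  rw [obliquePoint_eq_affineCombination, Affine.Simplex.closedInterior,
    Affine.Simplex.affineCombination_mem_setInterior_iff]
  · simp only [Fin.forall_fin_succ, Set.mem_Icc, Matrix.cons_val_zero,
      Matrix.cons_val_succ, sub_nonneg, div_le_one hS, sub_le_self_iff, IsEmpty.forall_iff,
      and_true, le_div_iff₀ hS, zero_mul]
    constructor
    · rintro ⟨⟨h1, -⟩, ⟨h2, -⟩, h3, -⟩
      exact ⟨h2, by linarith, h3⟩
    · rintro ⟨h1, h2, h3⟩
      exact ⟨⟨by linarith, by linarith⟩, ⟨h1, by linarith⟩, h3, h1.trans h2⟩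
  · rw [Fin.sum_univ_three]
    simp only [Matrix.cons_val]
    ring

theorem obliquePoint_surjective (T : Affine.Triangle ℝ Plane) (q : Plane) :
    ∃ x y, obliquePoint T x y = q := by
  have hS := (selectedSide_pos T).ne'
  have htop : affineSpan ℝ (Set.range T.points) = ⊤ := by
    rw [T.independent.affineSpan_eq_top_iff_card_eq_finrank_add_one]
    simp
  obtain ⟨w, hw, hq⟩ := eq_affineCombination_of_mem_affineSpan_of_fintype
    (show q ∈ affineSpan ℝ (Set.range T.points) by rw [htop]; trivial)
  refine ⟨selectedSide T * (1 - w 2), selectedSide T * w 1, ?_⟩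
  rw [hq, obliquePoint_eq_affineCombination]
  congr 1
  rw [Fin.sum_univ_three] at hw
  ext i
  fin_cases i <;> simp only [Matrix.cons_val, Fin.zero_eta, Fin.mk_one, Fin.reduceFinMk] <;>
    field_simp <;> linarith

/-- Membership of the point with oblique coordinates `(x, y)` in a placed unit triangle. -/
def Placement.Mem : Placement → ℝ → ℝ → Prop
  | ⟨.up, a, b⟩, x, y => 0 ≤ y - b ∧ y - b ≤ x - a ∧ x - a ≤ 1
  | ⟨.down, a, b⟩, x, y => 0 ≤ b - y ∧ b - y ≤ a - x ∧ a - x ≤ 1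

theorem Placement.obliquePoint_mem_toSet_iff (T : Affine.Triangle ℝ Plane) (P : Placement)
    (x y : ℝ) : obliquePoint T x y ∈ P.toSet T ↔ P.Mem x y := by
  have hS := selectedSide_pos T
  have key : ∀ u v : ℝ, obliquePoint T (selectedSide T * u) (selectedSide T * v) ∈
      T.closedInterior ↔ 0 ≤ v ∧ v ≤ u ∧ u ≤ 1 := fun u v => by
    rw [obliquePoint_mem_closedInterior_iff, mul_nonneg_iff_of_pos_left hS,
      mul_le_mul_iff_right₀ hS, mul_le_iff_le_one_right hS]
  rcases P with ⟨_ | _, a, b⟩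
  · rw [Placement.Mem, ← key]
    have e : obliquePoint T a b + (1 / selectedSide T) •
        (obliquePoint T (selectedSide T * (x - a)) (selectedSide T * (y - b)) - T.points 2) =
        obliquePoint T x y := by
      simp only [obliquePoint, mul_div_cancel_left₀ _ hS.ne']
      module
    constructor
    · rintro ⟨z, hz, hzx⟩
      have := smul_right_injective Plane (one_div_pos.2 hS).ne' (add_left_cancel (hzx.trans e.symm))
      rwa [← sub_left_injective this]
    · exact fun h => ⟨_, h, e⟩
  · rw [Placement.Mem, ← key]
    have e : obliquePoint T a b - (1 / selectedSide T) •
        (obliquePoint T (selectedSide T * (a - x)) (selectedSide T * (b - y)) - T.points 2) =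
        obliquePoint T x y := by
      simp only [obliquePoint, mul_div_cancel_left₀ _ hS.ne']
      module
    constructor
    · rintro ⟨z, hz, hzx⟩
      have := smul_right_injective Plane (one_div_pos.2 hS).ne' (sub_right_injective (hzx.trans e.symm))
      rwa [← sub_left_injective this]
    · exact fun h => ⟨_, h, e⟩

theorem isHomotheticUnit_iff (T : Affine.Triangle ℝ Plane) (A : Set Plane) :
    IsHomotheticUnit T A ↔ ∃ P : Placement, A = P.toSet T := by
  have hS := selectedSide_pos T
  constructor
  · rintro ⟨r, v, hr, rfl⟩
    -- The image of the apex fixes the position; the sign of `r` fixes the orientation.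
    obtain ⟨a, b, hab⟩ := obliquePoint_surjective T (v + r • T.points 2)
    rw [← eq_div_iff hS.ne'] at hr
    rcases abs_eq (one_div_pos.2 hS).le |>.1 hr with h | h
    · refine ⟨⟨.up, a, b⟩, Set.image_congr fun x _ => ?_⟩
      rw [hab, h]
      module
    · refine ⟨⟨.down, a, b⟩, Set.image_congr fun x _ => ?_⟩
      rw [hab, h]
      module
  · rintro ⟨⟨_ | _, a, b⟩, rfl⟩
    · refine ⟨1 / selectedSide T, obliquePoint T a b - (1 / selectedSide T) • T.points 2, ?_,
        Set.image_congr fun x _ => by module⟩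
      rw [abs_of_pos (one_div_pos.2 hS), one_div_mul_cancel hS.ne']
    · refine ⟨-(1 / selectedSide T), obliquePoint T a b + (1 / selectedSide T) • T.points 2, ?_,
        Set.image_congr fun x _ => by module⟩
      rw [abs_neg, abs_of_pos (one_div_pos.2 hS), one_div_mul_cancel hS.ne']

/-- The placements in `L` cover the triangle of side `s`. -/
def Covers (L : List Placement) (s : ℝ) : Prop :=
  ∀ x y, 0 ≤ y → y ≤ x → x ≤ s → ∃ P ∈ L, P.Mem x y

theorem isUnitCovering_map_toSet_iff (T : Affine.Triangle ℝ Plane) (L : List Placement) :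
    IsUnitCovering T (L.map (Placement.toSet T)) ↔ Covers L (selectedSide T) := by
  constructor
  · rintro ⟨-, h⟩ x y h0 hyx hx
    obtain ⟨A, hA, hxA⟩ := h ((obliquePoint_mem_closedInterior_iff T x y).2 ⟨h0, hyx, hx⟩)
    obtain ⟨P, hP, rfl⟩ := List.mem_map.1 hA
    exact ⟨P, hP, (P.obliquePoint_mem_toSet_iff T x y).1 hxA⟩
  · refine fun h => ⟨fun A hA => ?_, fun q hq => ?_⟩
    · obtain ⟨P, -, rfl⟩ := List.mem_map.1 hA
      exact (isHomotheticUnit_iff T _).2 ⟨P, rfl⟩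
    · obtain ⟨x, y, rfl⟩ := obliquePoint_surjective T q
      obtain ⟨h0, hyx, hx⟩ := (obliquePoint_mem_closedInterior_iff T x y).1 hq
      obtain ⟨P, hP, hm⟩ := h x y h0 hyx hx
      exact ⟨_, List.mem_map_of_mem hP, (P.obliquePoint_mem_toSet_iff T x y).2 hm⟩

theorem CanBeCoveredWith.exists_covers {T : Affine.Triangle ℝ Plane} {N : ℕ}
    (h : CanBeCoveredWith T N) :
    ∃ L : List Placement, L.length = N ∧ Covers L (selectedSide T) := by
  obtain ⟨L, hL, hcov⟩ := h
  have : L ∈ Set.range (List.map (Placement.toSet T)) := by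
    rw [Set.range_list_map]
    intro A hA
    obtain ⟨P, rfl⟩ := (isHomotheticUnit_iff T A).1 (hcov.1 A hA)
    exact ⟨P, rfl⟩
  obtain ⟨L, rfl⟩ := this
  exact ⟨L, by simpa using hL, (isUnitCovering_map_toSet_iff T L).1 hcov⟩

/-! ### The lower bound -/

/-- The length of the cross-section of a placed unit triangle at depth `x`. -/
def Placement.width : Placement → ℝ → ℝ
  | ⟨.up, a, _⟩, x => if 0 ≤ x - a ∧ x - a ≤ 1 then x - a else 0
  | ⟨.down, a, _⟩, x => if 0 ≤ a - x ∧ a - x ≤ 1 then a - x else 0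

/-- The total width of a placed unit triangle over all depths congruent to `t` modulo `1`. -/
def Placement.fractWidth : Placement → ℝ → ℝ
  | ⟨.up, a, _⟩, t => Int.fract (t - a)
  | ⟨.down, a, _⟩, t => Int.fract (a - t)

theorem Placement.width_nonneg (P : Placement) (x : ℝ) : 0 ≤ P.width x := by
  rcases P with ⟨_ | _, a, b⟩ <;> simp only [Placement.width] <;> split_ifs with h <;>
    first | exact h.1 | exact le_rfl

theorem Placement.volume_section_le (P : Placement) (x : ℝ) :
    volume {y | P.Mem x y} ≤ ENNReal.ofReal (P.width x) := by
  rcases P with ⟨_ | _, a, b⟩ <;> simp only [Placement.width, Placement.Mem] <;> split_ifs with h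
  · refine (measure_mono (t := Set.Icc b (b + (x - a))) fun y hy => ?_).trans ?_
    · simp only [Set.mem_ofPred_eq] at hy
      constructor <;> linarith
    · rw [Real.volume_Icc, add_sub_cancel_left]
  · refine (measure_mono_null (t := ∅) (fun y hy => ?_) measure_empty).le.trans zero_le
    exact (h ⟨hy.1.trans hy.2.1, hy.2.2⟩).elim
  · refine (measure_mono (t := Set.Icc (b - (a - x)) b) fun y hy => ?_).trans ?_
    · simp only [Set.mem_ofPred_eq] at hy
      constructor <;> linarith
    · rw [Real.volume_Icc, sub_sub_cancel]
  · refine (measure_mono_null (t := ∅) (fun y hy => ?_) measure_empty).le.trans zero_le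
    exact (h ⟨hy.1.trans hy.2.1, hy.2.2⟩).elim

/-- Subadditivity of length on the slice `[0, x]` at depth `x`. -/
theorem Covers.le_sum_width {L : List Placement} {s : ℝ} (h : Covers L s) {x : ℝ} (hx : x ≤ s) :
    x ≤ ∑ i : Fin L.length, (L.get i).width x := by
  have hsub : Set.Icc 0 x ⊆ ⋃ i : Fin L.length, {y | (L.get i).Mem x y} := fun y hy => by
    obtain ⟨P, hP, hm⟩ := h x y hy.1 hy.2 hx
    obtain ⟨i, rfl⟩ := List.mem_iff_get.1 hP
    exact Set.mem_iUnion.2 ⟨i, hm⟩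
  have := (measure_mono hsub).trans ((measure_iUnion_fintype_le volume _).trans
    (Finset.sum_le_sum fun i _ => (L.get i).volume_section_le x))
  rw [Real.volume_Icc, sub_zero, ← ENNReal.ofReal_sum_of_nonneg fun i _ => Placement.width_nonneg _ _] at this
  exact (ENNReal.ofReal_le_ofReal_iff (Finset.sum_nonneg fun i _ => Placement.width_nonneg _ _)).1 this

/-- A triangle has height `1` in depth, so for generic `t` at most one of the depths `t + k` meets
it, and its width there is the sawtooth value. -/
theorem Placement.sum_width_le_fractWidth (P : Placement) {t : ℝ}
    (ht : ∀ z : ℤ, t ≠ P.depth + z) (M : ℕ) :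
    ∑ k ∈ Finset.range M, P.width (t + k) ≤ P.fractWidth t := by
  have key : ∀ (f : ℕ → ℝ) (c : ℝ), 0 ≤ c → (∀ k, f k = 0 ∨ f k = c) →
      (∀ k l, f k ≠ 0 → f l ≠ 0 → k = l) → ∑ k ∈ Finset.range M, f k ≤ c := by
    intro f c hc hf hu
    by_cases h : ∃ k ∈ Finset.range M, f k ≠ 0
    · obtain ⟨k, hk, hfk⟩ := h
      rw [Finset.sum_eq_single_of_mem k hk fun l _ hl => by_contra fun hfl => hl (hu l k hfl hfk)]
      exact ((hf k).resolve_left hfk).le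
    · push Not at h
      rw [Finset.sum_eq_zero h]
      exact hc
  rcases P with ⟨_ | _, a, b⟩
  · have hfr : ∀ k : ℕ, 0 ≤ t + k - a ∧ t + k - a ≤ 1 → (k : ℤ) = -⌊t - a⌋ := fun k hk => by
      have : ⌊t - a⌋ = -(k : ℤ) := by
        rw [Int.floor_eq_iff]
        push_cast
        -- Equality would put the slice on the horizontal leg, where the width is `1` but the
        -- sawtooth is `0`; `ht` excludes it.
        refine ⟨by linarith, lt_of_le_of_ne (by linarith) fun h => ht (1 - k) ?_⟩
        push_cast
        linarith
      omega
    refine key _ _ (Int.fract_nonneg _) (fun k => ?_) (fun k l hk hl => ?_)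
    · simp only [Placement.width, Placement.fractWidth]
      split_ifs with h
      · right
        have h1 : ((k : ℤ) : ℝ) = -⌊t - a⌋ := by exact_mod_cast hfr k h
        push_cast at h1
        rw [Int.fract, h1]
        ring
      · exact .inl rfl
    · simp only [Placement.width, ne_eq, ite_eq_right_iff, not_forall, exists_prop] at hk hl
      have h1 := hfr k hk.1
      have h2 := hfr l hl.1
      omega
  · have hfr : ∀ k : ℕ, 0 ≤ a - (t + k) ∧ a - (t + k) ≤ 1 → (k : ℤ) = ⌊a - t⌋ := fun k hk => by
      have : ⌊a - t⌋ = (k : ℤ) := by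
        rw [Int.floor_eq_iff]
        push_cast
        refine ⟨by linarith, lt_of_le_of_ne (by linarith) fun h => ht (-1 - k) ?_⟩
        push_cast
        linarith
      omega
    refine key _ _ (Int.fract_nonneg _) (fun k => ?_) (fun k l hk hl => ?_)
    · simp only [Placement.width, Placement.fractWidth]
      split_ifs with h
      · right
        have h1 : ((k : ℤ) : ℝ) = ⌊a - t⌋ := by exact_mod_cast hfr k h
        push_cast at h1
        rw [Int.fract, h1]
        ring
      · exact .inl rfl
    · simp only [Placement.width, ne_eq, ite_eq_right_iff, not_forall, exists_prop] at hk hl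
      have h1 := hfr k hk.1
      have h2 := hfr l hl.1
      omega

theorem fract_periodic : Function.Periodic (Int.fract : ℝ → ℝ) 1 := fun x => Int.fract_add_one x

theorem intervalIntegrable_of_mem_Icc {f : ℝ → ℝ} (hm : Measurable f)
    (h : ∀ x, f x ∈ Set.Icc 0 1) (a b : ℝ) : IntervalIntegrable f volume a b :=
  (intervalIntegrable_const (c := (1 : ℝ))).mono_fun hm.aestronglyMeasurable
    (.of_forall fun x => by simpa [abs_of_nonneg (h x).1] using (h x).2)

theorem fract_mem_Icc (x : ℝ) : Int.fract x ∈ Set.Icc (0 : ℝ) 1 :=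
  ⟨Int.fract_nonneg x, (Int.fract_lt_one x).le⟩

theorem intervalIntegrable_fract_mul_add (m c a b : ℝ) :
    IntervalIntegrable (fun t => Int.fract (m * t + c)) volume a b :=
  intervalIntegrable_of_mem_Icc (measurable_fract.comp (by fun_prop)) (fun _ => fract_mem_Icc _) a b

/-- The average of the sawtooth function over an integral number of periods is `1 / 2`. -/
theorem integral_fract_int_mul_add {m : ℤ} (hm : m ≠ 0) (c : ℝ) :
    ∫ t in (0 : ℝ)..1, Int.fract ((m : ℝ) * t + c) = 1 / 2 := by
  have hm' : (m : ℝ) ≠ 0 := Int.cast_ne_zero.2 hm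
  have h0 : ∫ t in (0 : ℝ)..1, Int.fract t = 1 / 2 := by
    rw [intervalIntegral.integral_congr_ae (g := fun t => t)]
    · simp
    · filter_upwards [compl_mem_ae_iff.2 (measure_singleton (1 : ℝ))] with t ht ht'
      rw [Set.uIoc_of_le zero_le_one] at ht'
      exact Int.fract_eq_self.2 ⟨ht'.1.le, lt_of_le_of_ne ht'.2 ht⟩
  have hint : ∀ a b : ℝ, IntervalIntegrable (Int.fract : ℝ → ℝ) volume a b :=
    intervalIntegrable_of_mem_Icc measurable_fract fract_mem_Icc
  rw [intervalIntegral.integral_comp_mul_add _ hm', mul_zero, zero_add, mul_one, add_comm]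
  -- After the substitution the interval consists of `m` periods, counted with sign.
  have h1 := fract_periodic.intervalIntegral_add_zsmul_eq m c hint
  rw [fract_periodic.intervalIntegral_add_eq c 0, zero_add, h0, zsmul_one] at h1
  rw [h1, zsmul_eq_mul, smul_eq_mul, inv_mul_cancel_left₀ hm']

/-- `1` for up-triangles, `-1` for down-triangles. -/
def Placement.sign (P : Placement) : ℤ :=
  match P.orientation with
  | .up => 1
  | .down => -1

theorem Placement.fractWidth_eq (P : Placement) (t : ℝ) :
    P.fractWidth t = Int.fract (P.sign * t + -P.sign * P.depth) := by
  rcases P with ⟨_ | _, a, b⟩ <;> simp only [Placement.sign, Placement.fractWidth] <;> push_cast <;>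
    congr 1 <;> ring

theorem Placement.sign_ne_zero (P : Placement) : P.sign ≠ 0 := by
  rcases P with ⟨_ | _, a, b⟩ <;> simp [Placement.sign]

theorem Placement.two_dvd_one_sub_sign (P : Placement) : (2 : ℤ) ∣ 1 - P.sign := by
  rcases P with ⟨_ | _, a, b⟩ <;> simp [Placement.sign]

/-- The deepest slice is at `t + M - 1`, hence the bound `s + 1` in `hM`. -/
theorem Covers.sum_le_sum_fractWidth {L : List Placement} {s : ℝ} (h : Covers L s) {t : ℝ}
    (ht : ∀ i : Fin L.length, ∀ z : ℤ, t ≠ (L.get i).depth + z) {M : ℕ}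
    (hM : t + M ≤ s + 1) :
    ∑ k ∈ Finset.range M, (t + k) ≤ ∑ i : Fin L.length, (L.get i).fractWidth t :=
  calc
    _ ≤ ∑ k ∈ Finset.range M, ∑ i : Fin L.length, (L.get i).width (t + k) := by
      refine Finset.sum_le_sum fun k hk => h.le_sum_width ?_
      have : ((k + 1 : ℕ) : ℝ) ≤ M := Nat.cast_le.2 (Finset.mem_range.1 hk)
      push_cast at this
      linarith
    _ = ∑ i : Fin L.length, ∑ k ∈ Finset.range M, (L.get i).width (t + k) := Finset.sum_comm
    _ ≤ _ := Finset.sum_le_sum fun i _ => (L.get i).sum_width_le_fractWidth (ht i) M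

theorem sum_range_add_cast (t : ℝ) (M : ℕ) :
    ∑ k ∈ Finset.range M, (t + k) = M * t + ((∑ k ∈ Finset.range M, (k : ℤ) : ℤ) : ℝ) := by
  rw [Finset.sum_add_distrib]
  simp

theorem sum_range_cast_id (M : ℕ) :
    ((∑ k ∈ Finset.range M, (k : ℤ) : ℤ) : ℝ) = M * (M - 1) / 2 := by
  induction M with
  | zero => simp
  | succ M ih => rw [Finset.sum_range_succ, Int.cast_add, ih]; push_cast; ring

/-- If `F ≥ G` and `F - G` is congruent to `φ` modulo `1`, then `F ≥ G + fract φ`. -/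
theorem add_fract_le {F G φ : ℝ} (h : G ≤ F) (z : ℤ) (hz : F - G = φ + z) : G + Int.fract φ ≤ F := by
  have h1 : Int.fract (F - G) = Int.fract φ := by rw [hz, Int.fract_add_intCast]
  have h2 : Int.fract (F - G) ≤ F - G := by
    have : 0 ≤ ⌊F - G⌋ := Int.floor_nonneg.2 (by linarith)
    have : (0 : ℝ) ≤ ⌊F - G⌋ := by exact_mod_cast this
    rw [Int.fract]
    linarith
  linarith

/-- A covering of a triangle of side `n + d` with unit triangles, where the number of triangles
has the parity of `n + 1`, has at least `n² + 2nd + 1` members. -/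
theorem Covers.le_length {L : List Placement} {n : ℕ} {d : ℝ} (hd0 : 0 < d) (hd1 : d < 1)
    (h : Covers L (n + d)) (hpar : (2 : ℤ) ∣ L.length - (n + 1)) :
    (n : ℝ) ^ 2 + 2 * n * d + 1 ≤ L.length := by
  set D : ℤ := ∑ i : Fin L.length, (L.get i).sign with hD
  set c : ℝ := ∑ i : Fin L.length, -((L.get i).sign : ℝ) * (L.get i).depth with hc
  -- `D` has the parity of the number of triangles, hence of `n + 1`.
  have hm : D - n ≠ 0 := by
    have : (2 : ℤ) ∣ L.length - D := by
      have e : (L.length : ℤ) - D = ∑ i : Fin L.length, (1 - (L.get i).sign) := by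
        simp [hD, Finset.sum_sub_distrib]
      rw [e]
      exact Finset.dvd_sum fun i _ => (L.get i).two_dvd_one_sub_sign
    omega
  -- the sawtooth sum is linear up to an integer
  have hF : ∀ t, ∃ z : ℤ, ∑ i : Fin L.length, (L.get i).fractWidth t = D * t + c + z := fun t => by
    refine ⟨-∑ i : Fin L.length, ⌊((L.get i).sign : ℝ) * t + -(L.get i).sign * (L.get i).depth⌋, ?_⟩
    simp only [Placement.fractWidth_eq, Int.fract, Finset.sum_sub_distrib, Finset.sum_add_distrib]
    push_cast [hD, hc, Finset.sum_mul]
    ring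
  -- One lower bound for both ranges of `t`, with the same slope `D - n`; only the indicator term
  -- sees `d`.
  have hpt : ∀ᵐ t : ℝ, t ∈ Set.Icc (0 : ℝ) 1 →
      n * t + (n * (n - 1) / 2 + (Set.indicator (Set.Iio d) (fun _ => (n : ℝ)) t) +
        Int.fract (((D - n : ℤ) : ℝ) * t + c)) ≤ ∑ i : Fin L.length, (L.get i).fractWidth t := by
    have hcount : (⋃ i : Fin L.length, Set.range fun z : ℤ => (L.get i).depth + z).Countable :=
      Set.countable_iUnion fun i => Set.countable_range _
    filter_upwards [hcount.ae_notMem volume] with t ht ht01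
    have ht' : ∀ i : Fin L.length, ∀ z : ℤ, t ≠ (L.get i).depth + z := fun i z hz =>
      ht (Set.mem_iUnion.2 ⟨i, z, hz.symm⟩)
    obtain ⟨z, hz⟩ := hF t
    by_cases htd : t < d
    · rw [Set.indicator_of_mem (show t ∈ Set.Iio d from htd)]
      have h1 := h.sum_le_sum_fractWidth ht' (M := n + 1) (by push_cast; linarith)
      rw [sum_range_add_cast] at h1
      have h2 := add_fract_le (φ := (D - n - 1) * t + c) h1
        (z - ∑ k ∈ Finset.range (n + 1), (k : ℤ)) (by rw [hz]; push_cast; ring)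
      -- The extra slice contributes `t + n`; its part `t` pays for changing the slope from `D - n -
      -- 1` to `D - n`.
      have h3 : Int.fract (((D - n : ℤ) : ℝ) * t + c) ≤ Int.fract (((D : ℝ) - n - 1) * t + c) + t := by
        have e : ((D - n : ℤ) : ℝ) * t + c = ((D : ℝ) - n - 1) * t + c + t := by push_cast; ring
        have h5 := Int.fract_add_le (((D : ℝ) - n - 1) * t + c) t
        rw [e]
        rw [Int.fract_eq_self.2 (⟨ht01.1, htd.trans hd1⟩ : 0 ≤ t ∧ t < 1)] at h5
        exact h5
      rw [sum_range_cast_id] at h2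
      push_cast at h2
      push_cast at h3 ⊢
      linarith
    · rw [Set.indicator_of_notMem (show t ∉ Set.Iio d from htd)]
      have h1 := h.sum_le_sum_fractWidth ht' (M := n) (by linarith [ht01.2])
      rw [sum_range_add_cast] at h1
      have h2 := add_fract_le (φ := ((D - n : ℤ) : ℝ) * t + c) h1
        (z - ∑ k ∈ Finset.range n, (k : ℤ)) (by rw [hz]; push_cast; ring)
      rw [sum_range_cast_id] at h2
      linarith
  have hindint : IntervalIntegrable (Set.indicator (Set.Iio d) fun _ => (n : ℝ)) volume 0 1 :=
    (intervalIntegrable_const (c := (n : ℝ))).mono_fun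
      (measurable_const.indicator measurableSet_Iio).aestronglyMeasurable
      (.of_forall fun t => norm_indicator_le_norm_self _ t)
  have hind : ∫ t in (0 : ℝ)..1, Set.indicator (Set.Iio d) (fun _ => (n : ℝ)) t = n * d := by
    rw [intervalIntegral.integral_of_le zero_le_one, integral_indicator measurableSet_Iio,
      Measure.restrict_restrict measurableSet_Iio]
    have : Set.Iio d ∩ Set.Ioc (0 : ℝ) 1 = Set.Ioo 0 d := by
      ext t
      simp only [Set.mem_inter_iff, Set.mem_Iio, Set.mem_Ioc, Set.mem_Ioo]
      constructor
      · exact fun h => ⟨h.2.1, h.1⟩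
      · exact fun h => ⟨h.2, h.1, by linarith [h.2]⟩
    rw [this]
    simp [hd0.le, mul_comm]
  have hi1 : IntervalIntegrable (fun t : ℝ => (n : ℝ) * t) volume 0 1 :=
    (continuous_const.mul continuous_id).intervalIntegrable _ _
  have hlin : ∫ t in (0 : ℝ)..1, (n : ℝ) * t = n / 2 := by
    rw [intervalIntegral.integral_const_mul, integral_id]
    ring
  have hi2 := intervalIntegrable_fract_mul_add ((D - n : ℤ) : ℝ) c 0 1
  have hi3 : ∀ P : Placement, IntervalIntegrable P.fractWidth volume 0 1 := fun P => by
    rw [funext P.fractWidth_eq]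
    exact intervalIntegrable_fract_mul_add _ _ _ _
  have hi4 : IntervalIntegrable (fun _ : ℝ => (n : ℝ) * (n - 1) / 2) volume 0 1 :=
    intervalIntegrable_const
  -- The integrals give `n / 2 + n * (n - 1) / 2 + n * d + 1 / 2 ≤ L.length / 2`.
  have hle := intervalIntegral.integral_mono_ae_restrict zero_le_one
    (hi1.add ((hi4.add hindint).add hi2))
    (IntervalIntegrable.sum Finset.univ fun i _ => hi3 (L.get i))
    ((ae_restrict_iff' measurableSet_Icc).2 (by simpa using hpt))
  have hr : ∫ t in (0 : ℝ)..1, (∑ i : Fin L.length, (L.get i).fractWidth) t = L.length / 2 := by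
    simp only [Finset.sum_apply]
    rw [intervalIntegral.integral_finsetSum fun i _ => hi3 (L.get i)]
    simp only [Placement.fractWidth_eq, ← Int.cast_neg]
    simp [integral_fract_int_mul_add (Placement.sign_ne_zero _), div_eq_mul_inv]
  rw [hr] at hle
  rw [intervalIntegral.integral_add hi1 ((hi4.add hindint).add hi2),
    intervalIntegral.integral_add (hi4.add hindint) hi2,
    intervalIntegral.integral_add hi4 hindint, hind, integral_fract_int_mul_add hm] at hle
  simp only [intervalIntegral.integral_const, smul_eq_mul] at hle
  linarith

/-! ### The construction -/

theorem length_row (w : ℕ) (y s : ℝ) : (row w y s).length = w + (w - 1) := by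
  simp [row]

/-- A row covers every depth of its trapezoid from the left diagonal up to the right end of its
last up-triangle. -/
theorem exists_mem_row {w : ℕ} (hw : 1 ≤ w) {y s x v : ℝ} (hx1 : y - 1 + s ≤ x)
    (hxy : x ≤ y) (hv0 : 0 ≤ v) (hv : v ≤ (w - 1) * (1 + s) + (x - y + 1)) :
    ∃ P ∈ row w y s, P.Mem x v := by
  induction w with
  | zero => omega
  | succ w ih =>
    -- The point is in the last up-triangle, in the range of the row without it, or in the gap
    -- between them, which the last down-triangle fills.
    by_cases h1 : w * (1 + s) ≤ v
    · refine ⟨⟨.up, y - 1, w * (1 + s)⟩, ?_, ?_⟩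
      · simp only [row, List.mem_append, List.mem_map, List.mem_range]
        exact .inl ⟨w, by omega, rfl⟩
      · push_cast at hv
        refine ⟨?_, ?_, ?_⟩ <;> linarith
    push Not at h1
    have hw0 : w ≠ 0 := by
      rintro rfl
      simp only [Nat.cast_zero, zero_mul] at h1
      linarith
    by_cases h2 : v ≤ (w - 1) * (1 + s) + (x - y + 1)
    · obtain ⟨P, hP, hm⟩ := ih (by omega) h2
      refine ⟨P, ?_, hm⟩
      simp only [row, List.mem_append, List.mem_map, List.mem_range] at hP ⊢
      rcases hP with ⟨i, hi, rfl⟩ | ⟨i, hi, rfl⟩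
      · exact .inl ⟨i, by omega, rfl⟩
      · exact .inr ⟨i, by omega, rfl⟩
    · push Not at h2
      obtain ⟨i, rfl⟩ := Nat.exists_eq_succ_of_ne_zero hw0
      refine ⟨⟨.down, y + s, ((i : ℝ) + 1) * (1 + s)⟩, ?_, ?_⟩
      · simp only [row, List.mem_append, List.mem_map, List.mem_range]
        exact .inr ⟨i, by omega, rfl⟩
      · push_cast at h1 h2
        refine ⟨?_, ?_, ?_⟩ <;> linarith

theorem rowDepth_succ {j k : ℕ} (hk : j ≤ k + 1) :
    rowDepth j (k + 1) = rowDepth j k + (1 - slideValue j (k + 1)) := by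
  rw [rowDepth, rowDepth, Finset.sum_Icc_succ_top hk, add_assoc]

/-- The sum telescopes, since the slide value is `(j - 1) * (1 / (i - 1) - 1 / i)`. The case `k = j
- 1` is the empty sum. -/
theorem rowDepth_eq {j k : ℕ} (hj : 2 ≤ j) (hk : j ≤ k + 1) :
    rowDepth j k = k + ((j : ℝ) - 1) / k := by
  obtain ⟨m, rfl⟩ : ∃ m, k = j - 1 + m := ⟨k - (j - 1), by omega⟩
  obtain ⟨i, rfl⟩ : ∃ i, j = i + 2 := ⟨j - 2, by omega⟩
  clear hj hk
  induction m with
  | zero =>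
    have : (i : ℝ) + 1 ≠ 0 := by positivity
    simp [rowDepth]
    field_simp
    ring
  | succ m ih =>
    rw [← add_assoc, rowDepth_succ (by omega), ih, slideValue]
    have h1 : (i : ℝ) + 1 + m ≠ 0 := by positivity
    have h2 : (i : ℝ) + 1 + m + 1 ≠ 0 := by positivity
    have h3 : i + 2 - 1 = i + 1 := rfl
    rw [h3]
    push_cast
    rw [add_sub_cancel_right]
    field_simp
    ring

/-- The depth reached by the first `k` rows of the method CoverTriangle (Basic Odd). -/
def coveredDepth (j k : ℕ) : ℝ :=
  if k = 0 then 0 else if k < j then (k : ℝ) + 1 else rowDepth j k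

theorem exists_mem_basicOddRow {j k : ℕ} (hj : 2 ≤ j) {x y : ℝ}
    (hx0 : coveredDepth j k ≤ x) (hx : x ≤ coveredDepth j (k + 1)) (hy0 : 0 ≤ y) (hyx : y ≤ x) :
    ∃ P ∈ basicOddRow j (k + 1), P.Mem x y := by
  unfold basicOddRow
  split_ifs with h1 hkj
  · obtain rfl : k = 0 := by omega
    simp only [coveredDepth, if_pos, zero_add, one_ne_zero, if_false, if_pos (show 1 < j by omega),
      Nat.cast_one] at hx0 hx
    by_cases hx1 : x ≤ 1
    · obtain ⟨P, hP, hm⟩ := exists_mem_row (w := 1) (y := 1) (s := 0) (by omega) (by linarith) hx1 hy0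
        (by push_cast; linarith)
      exact ⟨P, List.mem_append_left _ hP, hm⟩
    · obtain ⟨P, hP, hm⟩ := exists_mem_row (w := 2) (y := 2) (s := 0) (by omega) (by linarith)
        (by linarith) hy0 (by push_cast; linarith)
      exact ⟨P, List.mem_append_right _ hP, hm⟩
  · rw [coveredDepth, if_neg (by omega), if_pos hkj] at hx
    rw [coveredDepth, if_neg (by omega), if_pos (by omega)] at hx0
    push_cast at hx
    refine exists_mem_row (by omega) ?_ ?_ hy0 ?_ <;> push_cast <;> linarith
  · have hprev : coveredDepth j k = rowDepth j k := by
      rw [coveredDepth, if_neg (by omega)]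
      split_ifs with h
      · obtain rfl : j = k + 1 := by omega
        simp [rowDepth]
      · rfl
    rw [hprev] at hx0
    rw [coveredDepth, if_neg (by omega), if_neg hkj] at hx
    have hk0 : (0 : ℝ) < k := by exact_mod_cast (by omega : 0 < k)
    refine exists_mem_row (by omega) ?_ hx hy0 ?_
    · rw [rowDepth_succ (by omega)]
      linarith
    · have e : ((k + 1 : ℕ) - 1 : ℝ) * (1 + slideValue j (k + 1)) + 1 = rowDepth j (k + 1) := by
        rw [rowDepth_eq hj (by omega), slideValue]
        push_cast
        rw [add_sub_cancel_right]
        field_simp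
        ring
      linarith

theorem coveredDepth_self {n j : ℕ} (hn : 1 ≤ n) (hj : 2 ≤ j) (hjn : j ≤ n + 1) :
    coveredDepth j n = n + ((j : ℝ) - 1) / n := by
  rw [coveredDepth, if_neg (by omega)]
  split_ifs with h
  · obtain rfl : j = n + 1 := by omega
    have : (n : ℝ) ≠ 0 := by positivity
    push_cast
    rw [add_sub_cancel_right, div_self this]
  · exact rowDepth_eq hj hjn

theorem covers_basicOddPlacements_coveredDepth (n : ℕ) {j : ℕ} (hn : 1 ≤ n) (hj : 2 ≤ j) :
    Covers (basicOddPlacements n j) (coveredDepth j n) := by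
  intro x y hy0 hyx hx
  suffices ∃ k < n, ∃ P ∈ basicOddRow j (k + 1), P.Mem x y by
    obtain ⟨k, hk, P, hP, hm⟩ := this
    exact ⟨P, List.mem_flatMap.2 ⟨k, List.mem_range.2 hk, hP⟩, hm⟩
  induction n, hn using Nat.le_induction with
  | base =>
    exact ⟨0, one_pos, exists_mem_basicOddRow hj ((if_pos rfl).trans_le (hy0.trans hyx)) hx hy0 hyx⟩
  | succ n hn ih =>
    by_cases h : x ≤ coveredDepth j n
    · obtain ⟨k, hk, hP⟩ := ih h
      exact ⟨k, by omega, hP⟩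
    · exact ⟨n, by omega, exists_mem_basicOddRow hj (not_le.1 h).le hx hy0 hyx⟩

/-- CoverTriangle (Basic Odd) covers the triangle of side `n + d` if `d ≤ (j - 1) / n`. -/
theorem isUnitCovering_basicOdd {n j : ℕ} {d : ℝ} {T : Affine.Triangle ℝ Plane} (hn : 1 ≤ n)
    (hj : 2 ≤ j) (hjn : j ≤ n + 1) (hT : selectedSide T = n + d) (hd : n * d ≤ j - 1) :
    IsUnitCovering T (basicOdd n j T) := by
  rw [basicOdd, isUnitCovering_map_toSet_iff]
  intro x y hy0 hyx hx
  refine covers_basicOddPlacements_coveredDepth n hn hj x y hy0 hyx (hx.trans ?_)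
  have : (0 : ℝ) < n := by exact_mod_cast hn
  rw [hT, coveredDepth_self hn hj hjn, add_le_add_iff_left, le_div_iff₀ this]
  linarith

/-- Rows before `j` cost one extra pair; row `1` costs one more, as `4 = 1 + 2 + 1`. -/
theorem length_basicOddRow {j k : ℕ} (hj : 2 ≤ j) :
    (basicOddRow j (k + 1)).length =
      (2 * k + 1) + (if k + 1 < j then 2 else 0) + if k = 0 then 1 else 0 := by
  unfold basicOddRow
  split_ifs <;> simp only [List.length_append, length_row] <;> omega

theorem length_basicOdd {n j : ℕ} (T : Affine.Triangle ℝ Plane) (hn : 1 ≤ n) (hj : 2 ≤ j)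
    (hjn : j ≤ n + 1) : (basicOdd n j T).length = n ^ 2 + 2 * (j - 1) + 1 := by
  -- The minimum counts the rows before `j`, so that the induction can run through row `j`.
  have h : ∀ n, 1 ≤ n → (basicOddPlacements n j).length = n ^ 2 + 2 * min n (j - 1) + 1 := by
    intro n hn
    induction n, hn using Nat.le_induction with
    | base =>
      simp [basicOddPlacements, length_basicOddRow (k := 0) hj]
      rw [if_pos (by omega)]
      omega
    | succ n hn ih =>
      rw [basicOddPlacements, List.range_succ, List.flatMap_append, List.length_append,
        ← basicOddPlacements, ih, List.flatMap_singleton, length_basicOddRow hj, if_neg (show ¬ n = 0 by omega)]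
      split_ifs
      · rw [min_eq_left (by omega), min_eq_left (by omega)]
        ring
      · rw [min_eq_right (by omega), min_eq_right (by omega)]
        ring
  rw [basicOdd, List.length_map, h n hn, min_eq_right (by omega)]

end TriangleCovering

end

/-! ### Optimality of the method -/

theorem theorem10 (n p : ℕ) (hp : 1 ≤ p) (hpn : p < n) (d : ℝ) (hd0 : 0 < d) (hd1 : d < 1)
    (T : Affine.Triangle ℝ TriangleCovering.Plane)
    (hT : TriangleCovering.selectedSide T = (n : ℝ) + d) :
    -- the output of Full Odd: a covering of `T`, with `n² + 2 (j - 1) + 1` triangles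
    (TriangleCovering.IsUnitCovering T (TriangleCovering.fullOdd n d T) ∧
      ((TriangleCovering.fullOdd n d T).length : ℤ) =
        (n : ℤ) ^ 2 + 2 * (⌈d * n + 1⌉ - 1) + 1) ∧
    -- it needs no more than `n² + 2p + 1` triangles exactly when `d ≤ p / n`
    ((TriangleCovering.fullOdd n d T).length ≤ n ^ 2 + 2 * p + 1 ↔ d ≤ (p : ℝ) / n) ∧
    -- if `d ≤ p / n`, the row `j = p + 1` gives a covering with exactly `n² + 2p + 1` triangles
    (d ≤ (p : ℝ) / n →
      TriangleCovering.IsUnitCovering T (TriangleCovering.basicOdd n (p + 1) T) ∧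
        (TriangleCovering.basicOdd n (p + 1) T).length = n ^ 2 + 2 * p + 1) ∧
    -- if `d > p / n`, there is no covering with `n² + 2p + 1` triangles at all
    ((p : ℝ) / n < d → ¬ TriangleCovering.CanBeCoveredWith T (n ^ 2 + 2 * p + 1)) := by
  have hn : 1 ≤ n := by omega
  have hn0 : (0 : ℝ) < n := by exact_mod_cast hn
  have hdn : 0 < d * n := by positivity
  have hj2 : 2 ≤ TriangleCovering.fullOddRow n d := by
    rw [TriangleCovering.fullOddRow, Nat.succ_le_iff, Nat.lt_ceil]
    push_cast
    linarith
  have hjn : TriangleCovering.fullOddRow n d ≤ n + 1 := by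
    rw [TriangleCovering.fullOddRow, Nat.ceil_le]
    push_cast
    nlinarith
  have hlen := TriangleCovering.length_basicOdd T hn hj2 hjn
  refine ⟨⟨TriangleCovering.isUnitCovering_basicOdd hn hj2 hjn hT ?_, ?_⟩, ?_, fun hd => ⟨?_, ?_⟩,
    fun hd hcov => ?_⟩
  · have : d * n + 1 ≤ TriangleCovering.fullOddRow n d := Nat.le_ceil _
    linarith
  · have : ((TriangleCovering.fullOddRow n d : ℕ) : ℤ) = ⌈d * n + 1⌉ :=
      Int.natCast_ceil_eq_ceil (by positivity)
    rw [TriangleCovering.fullOdd, hlen, ← this]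
    push_cast [Nat.cast_sub (show 1 ≤ TriangleCovering.fullOddRow n d by omega)]
    ring
  · have : TriangleCovering.fullOddRow n d ≤ p + 1 ↔ d ≤ (p : ℝ) / n := by
      rw [TriangleCovering.fullOddRow, Nat.ceil_le, le_div_iff₀ hn0]
      push_cast
      rw [add_le_add_iff_right]
    rw [TriangleCovering.fullOdd, hlen, ← this]
    omega
  · refine TriangleCovering.isUnitCovering_basicOdd hn (by omega) (by omega) hT ?_
    rw [le_div_iff₀ hn0] at hd
    push_cast
    linarith
  · rw [TriangleCovering.length_basicOdd T hn (by omega) (by omega), Nat.add_sub_cancel]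
  · obtain ⟨L, hL, hc⟩ := hcov.exists_covers
    rw [hT] at hc
    -- The parity needed for the lower bound holds because `n * (n - 1)` is even.
    have hpar : (2 : ℤ) ∣ L.length - (n + 1) := by
      have : (L.length : ℤ) - (n + 1) = n * (n - 1) + 2 * p := by
        rw [hL]
        push_cast
        ring
      rw [this]
      exact dvd_add (Int.even_mul_pred_self n).two_dvd (dvd_mul_right _ _)
    have := hc.le_length hd0 hd1 hpar
    rw [hL] at this
    push_cast at this
    rw [div_lt_iff₀ hn0] at hd
    nlinarith
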